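/- Let $\mathbf 1=(1,1,1,1)^T$ and let $e_i\in\mathbb R^4$ ($1\le i\le 3$) be the column whose first $i$ entries are $1$ and whose other entries are $0$. For columns $x,y,u,v$ of length $4$ let $\mathrm{per}[x,y,u,v]$ be the permanent of the $4\times4$ matrix with these columns. In the variables $X=(a,b,c,d,a',b',c',d')$ let $$x=(a+b^2+c^2+d^2,\;a+c^2+d^2,\;a+d^2,\;a)^T,\qquad y=(a'+b'^2+c'^2+d'^2,\;a'+c'^2+d'^2,\;a'+d'^2,\;a')^T$$ (generic weakly decreasing real columns), and for $i,j\in\{1,2,3\}$ define the polynomials arising from the Monotone Column Permanent (MCP) conjecture in dimension $4$ by $$p_{i,j}=\mathrm{per}[x,y,e_i,\mathbf 1]\;\mathrm{per}[x,y,e_j,\mathbf 1]-\mathrm{per}[x,y,\mathbf 1,\mathbf 1]\;\mathrm{per}[x,y,e_i,e_j]\in\mathbb Q[X].$$ For $f\in\mathbb R[X]$ let $\mathcal G_f$ be the set of terms $X^\alpha$ such that $2\alpha$ lies in the convex hull of $\{\beta : X^\beta\in\mathrm{supp}(f)\}$, and let $m_f$ be the number of terms in $\mathcal G_f\cdot\mathcal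 G_f=\{X^{\alpha+\beta} : X^\alpha,X^\beta\in\mathcal G_f\}$. A rational Farkas certificate for $f$ is a vector $\hat y\in\mathbb Q^{m_f}$, indexed by the terms in $\mathcal G_f\cdot\mathcal G_f$ and extended by zero to all terms, whose linear form $L_{\hat y}(g)=\sum_\alpha \hat y_\alpha g_\alpha$ satisfies $L_{\hat y}(u^2)\ge 0$ for every $u\in\mathbb R[X]$ with $\mathrm{supp}(u)\subseteq\mathcal G_f$, and $L_{\hat y}(f)<0$. Then each of $p_{1,2}$, $p_{2,2}$, $p_{2,3}$ is a polynomial of degree $8$ in the $8$ variables $X$, has a rational Farkas certificate, and is not a sum of squares of polynomials in $\mathbb R[X]$. Consequently non-constant denominators are necessary: none of the three can be written as $\sum_i u_i^2/\sum_j v_j^2$ with $u_i\in\mathbb R[X]$ and real constants $v_j$, $\sum_j v_j^2\ne 0$. Moreover, the block matrices of the corresponding semidefinite programs, whose order is $\#\mathcal G_f+1$, have order $24$, $29$, $39$ for $f=p_{1,2},p_{2,2},p_{2,3}$, and the certificate lengths $m_f$ are $189$, $255$, $372$, respectively. -/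

import Mathlib

open scoped Pointwise

noncomputable section

/-! ### The polynomials from the Monotone Column Permanent conjecture in dimension 4 -/

/-- A weakly decreasing column of length `4`: its last entry is `a`, and the gaps between
consecutive entries are the squares `b ^ 2`, `c ^ 2`, `d ^ 2`. -/
def mcpColumn {R : Type*} [CommRing R] (a b c d : R) : Fin 4 → R :=
  ![a + b ^ 2 + c ^ 2 + d ^ 2, a + c ^ 2 + d ^ 2, a + d ^ 2, a]

/-- The `0/1`-column of length `4` whose first `i` entries are `1`; the all-ones column is
`mcpStep R 4`. -/
def mcpStep (R : Type*) [CommRing R] (i : ℕ) : Fin 4 → R :=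
  fun r => if (r : ℕ) < i then 1 else 0

/-- The permanent of the `4 × 4` matrix with columns `x`, `y`, `u`, `v`. -/
def mcpPerm {R : Type*} [CommRing R] (x y u v : Fin 4 → R) : R :=
  (Matrix.of fun r : Fin 4 => ![x r, y r, u r, v r]).permanent

/-- Write `1` for the all-ones column and `e i` for the column whose first `i` entries are `1`.
The value is `per[x,y,eᵢ,1] * per[x,y,eⱼ,1] - per[x,y,1,1] * per[x,y,eᵢ,eⱼ]`, that is
`∂₁F * ∂₂F - F * ∂₁∂₂F` for the polynomial
`F(z₁, z₂) = per[x, y, z₁ • 1 + eᵢ, z₂ • 1 + eⱼ]`. -/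
def mcpForm {R : Type*} [CommRing R] (i j : ℕ) (x y : Fin 4 → R) : R :=
  mcpPerm x y (mcpStep R i) (mcpStep R 4) * mcpPerm x y (mcpStep R j) (mcpStep R 4)
    - mcpPerm x y (mcpStep R 4) (mcpStep R 4) * mcpPerm x y (mcpStep R i) (mcpStep R j)

open MvPolynomial in
/-- The polynomial `p_{i,j}` in `8` variables: `mcpForm i j` at two generic weakly decreasing
real columns. -/
def mcpPoly (i j : ℕ) : MvPolynomial (Fin 8) ℝ :=
  mcpForm i j (mcpColumn (X 0) (X 1) (X 2) (X 3)) (mcpColumn (X 4) (X 5) (X 6) (X 7))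

/-! ### Sums of squares, Hilbert-Artin representations, Farkas certificates

Terms are identified with their exponent vectors `α : Fin n →₀ ℕ`. -/

/-- The set of terms of total degree at most `e` in `n` variables. -/
def termsLE (n e : ℕ) : Set (Fin n →₀ ℕ) := {α | α.degree ≤ e}

/-- The rational functions `∑ uᵢ² / ∑ vⱼ²` (with `∑ vⱼ² ≠ 0`) where `uᵢ`, `vⱼ` are real
polynomials and all terms of every `vⱼ` lie in `T`. -/
def RSOS {n : ℕ} (T : Set (Fin n →₀ ℕ)) : Set (FractionRing (MvPolynomial (Fin n) ℝ)) :=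
  {r | ∃ (l l' : ℕ) (u : Fin l → MvPolynomial (Fin n) ℝ) (v : Fin l' → MvPolynomial (Fin n) ℝ),
    (∀ j, (↑(v j).support : Set (Fin n →₀ ℕ)) ⊆ T) ∧ ∑ j, v j ^ 2 ≠ 0 ∧
    r = algebraMap _ (FractionRing (MvPolynomial (Fin n) ℝ)) (∑ i, u i ^ 2) /
        algebraMap _ (FractionRing (MvPolynomial (Fin n) ℝ)) (∑ j, v j ^ 2)}

/-- The exponent vector `α` as a point of `ℝⁿ`. -/
def expPoint {n : ℕ} (α : Fin n →₀ ℕ) : Fin n → ℝ := fun i => (α i : ℝ)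

/-- The sparse set `𝒢_{f,T}` of terms: all `α` such that `2 α` lies in the convex hull of the
exponents `β + γ₁ + γ₂` with `β` in the support of `f` and `γ₁, γ₂ ∈ T`. -/
def sparseTerms {n : ℕ} (f : MvPolynomial (Fin n) ℝ) (T : Set (Fin n →₀ ℕ)) :
    Set (Fin n →₀ ℕ) :=
  {α | expPoint (2 • α) ∈
    convexHull ℝ (expPoint '' ((↑f.support : Set (Fin n →₀ ℕ)) + T + T))}

/-- The linear form `L_y` on polynomials attached to a vector `y` of rational numbers indexed by
terms: `L_y(f) = ∑_α f_α y_α`. -/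
def momentForm {n : ℕ} (y : (Fin n →₀ ℕ) → ℚ) (f : MvPolynomial (Fin n) ℝ) : ℝ :=
  ∑ α ∈ f.support, f.coeff α * (y α : ℝ)

/-- `y` is a rational Farkas certificate (in sparse form) that `f` has no Hilbert-Artin
representation with denominator terms in `T`: with `G = 𝒢_{f,T}`, it is a vector indexed by the
terms in `G + G` (it is zero elsewhere), `L_y(u²) ≥ 0` whenever all terms of `u` lie in `G`, and
`L_y(f v²) < 0` for every nonzero `v` all of whose terms lie in `T`. -/
def IsFarkasCertificate {n : ℕ} (f : MvPolynomial (Fin n) ℝ) (T : Set (Fin n →₀ ℕ))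
    (y : (Fin n →₀ ℕ) → ℚ) : Prop :=
  Function.support y ⊆ sparseTerms f T + sparseTerms f T ∧
  (∀ u : MvPolynomial (Fin n) ℝ, (↑u.support : Set (Fin n →₀ ℕ)) ⊆ sparseTerms f T →
    0 ≤ momentForm y (u ^ 2)) ∧
  (∀ v : MvPolynomial (Fin n) ℝ, v ≠ 0 → (↑v.support : Set (Fin n →₀ ℕ)) ⊆ T →
    momentForm y (f * v ^ 2) < 0)

/-- The order of the block matrices in the semidefinite program for `f` and `T` after sparsity
has been exploited: one block indexed by `𝒢_{f,T}` and one indexed by `T`. -/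
def sdpDim {n : ℕ} (f : MvPolynomial (Fin n) ℝ) (T : Set (Fin n →₀ ℕ)) : ℕ :=
  (sparseTerms f T).ncard + T.ncard

/-- The number of terms that index a sparse Farkas certificate, `#(𝒢_{f,T} + 𝒢_{f,T})`. -/
def certificateLength {n : ℕ} (f : MvPolynomial (Fin n) ℝ) (T : Set (Fin n →₀ ℕ)) : ℕ :=
  (sparseTerms f T + sparseTerms f T).ncard

end

/-!
The weakly decreasing column with parameters `a, b, c, d` is a combination of the four step columns
with coefficients `b², c², d², a`, and the permanent of four step columns is a rook number. Since
the permanent is multilinear, this expands `p_{i,j}` into products of two of `b², c², d², a` and two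
of `b'², c'², d'², a'`; after symmetrization all coefficients are nonnegative, so no terms cancel
and the support can be read off. The set `𝒢_f` is then cut out by a few linear inequalities that
hold on half the support, because the square of every term satisfying them lies in the support.

If `f · ∑ vⱼ² = ∑ uᵢ²`, then at a vertex of the joint Newton polytope of the `uᵢ` the squares
cannot cancel, so the terms of all `uᵢ` lie in the sparse set and a Farkas certificate takes a
nonnegative value on the right-hand side and a negative one on the left. For the certificates below,
`L_y(u²) ≥ 0` holds because the moment matrix of `y` on `𝒢_f` is the Gram matrix of an explicit
family of vectors.
-/

/-! ### Linear forms given by moments -/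

section MomentForm

variable {n : ℕ} (y : (Fin n →₀ ℕ) → ℚ)

/-- The linear form `L_y` of `momentForm`, bundled as a linear map. -/
noncomputable def momentLinear : MvPolynomial (Fin n) ℝ →ₗ[ℝ] ℝ :=
  (MvPolynomial.basisMonomials (Fin n) ℝ).constr ℝ fun α => (y α : ℝ)

theorem momentLinear_monomial (α : Fin n →₀ ℕ) (c : ℝ) :
    momentLinear y (MvPolynomial.monomial α c) = c * y α := by
  have h := (MvPolynomial.basisMonomials (Fin n) ℝ).constr_basis ℝ (fun α => (y α : ℝ)) α
  rw [MvPolynomial.coe_basisMonomials] at h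
  rw [← mul_one c, ← smul_eq_mul, ← MvPolynomial.smul_monomial, map_smul, momentLinear, h,
    smul_eq_mul, smul_eq_mul, mul_one]

theorem momentLinear_apply (f : MvPolynomial (Fin n) ℝ) : momentLinear y f = momentForm y f := by
  conv_lhs => rw [f.as_sum]
  simp only [map_sum, momentLinear_monomial, momentForm]

theorem momentForm_sum {ι : Type*} (s : Finset ι) (f : ι → MvPolynomial (Fin n) ℝ) :
    momentForm y (∑ i ∈ s, f i) = ∑ i ∈ s, momentForm y (f i) := by
  simp only [← momentLinear_apply, map_sum]

theorem momentForm_monomial (α : Fin n →₀ ℕ) (c : ℝ) :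
    momentForm y (MvPolynomial.monomial α c) = c * y α := by
  rw [← momentLinear_apply, momentLinear_monomial]

theorem momentForm_sq (u : MvPolynomial (Fin n) ℝ) :
    momentForm y (u ^ 2) =
      ∑ α ∈ u.support, ∑ β ∈ u.support, u.coeff α * u.coeff β * y (α + β) := by
  conv_lhs => rw [u.as_sum, sq, Finset.sum_mul_sum]
  simp only [MvPolynomial.monomial_mul, momentForm_sum, momentForm_monomial]

theorem momentForm_sq_nonneg_of_gram {κ : Type*} [Fintype κ] (v : κ → (Fin n →₀ ℕ) → ℝ)
    {u : MvPolynomial (Fin n) ℝ}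
    (hv : ∀ α ∈ u.support, ∀ β ∈ u.support, (y (α + β) : ℝ) = ∑ k, v k α * v k β) :
    0 ≤ momentForm y (u ^ 2) := by
  have sq_eq : momentForm y (u ^ 2) = ∑ k, (∑ α ∈ u.support, u.coeff α * v k α) ^ 2 := by
    simp_rw [momentForm_sq, sq, Finset.sum_mul_sum]
    rw [Finset.sum_comm (s := Finset.univ)]
    refine Finset.sum_congr rfl fun α hα => ?_
    rw [Finset.sum_comm (s := Finset.univ)]
    refine Finset.sum_congr rfl fun β hβ => ?_
    rw [hv α hα β hβ, Finset.mul_sum]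
    exact Finset.sum_congr rfl fun k _ => by ring
  rw [sq_eq]
  exact Finset.sum_nonneg fun k _ => sq_nonneg _

end MomentForm

/-! ### Sums of squares and Newton polytopes -/

theorem exists_eq_sum_sq_of_isSumSq {R : Type*} [CommSemiring R] {a : R} (ha : IsSumSq a) :
    ∃ (l : ℕ) (u : Fin l → R), a = ∑ i, u i ^ 2 := by
  induction ha with
  | zero => exact ⟨0, Fin.elim0, by rw [Fin.sum_univ_zero]⟩
  | sq_add b _ ih =>
    obtain ⟨l, u, rfl⟩ := ih
    exact ⟨l + 1, Fin.cons b u, by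
      simp only [Fin.sum_univ_succ, Fin.cons_zero, Fin.cons_succ, sq]⟩

theorem coeff_add_self_sq {σ R : Type*} [CommSemiring R] {g : MvPolynomial σ R} {γ : σ →₀ ℕ}
    (h : ∀ β ∈ g.support, ∀ δ ∈ g.support, β + δ = γ + γ → β = γ) :
    (g ^ 2).coeff (γ + γ) = g.coeff γ ^ 2 := by
  classical
  rw [sq, MvPolynomial.coeff_mul, Finset.sum_eq_single (γ, γ), sq]
  · rintro ⟨β, δ⟩ hβδ hne
    rw [Finset.HasAntidiagonal.mem_antidiagonal] at hβδ
    by_contra hcoeff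
    obtain rfl : β = γ := h β (MvPolynomial.mem_support_iff.2 (left_ne_zero_of_mul hcoeff)) δ
      (MvPolynomial.mem_support_iff.2 (right_ne_zero_of_mul hcoeff)) hβδ
    exact hne (Prod.ext rfl (add_left_cancel hβδ))
  · exact fun hγ => (hγ (Finset.HasAntidiagonal.mem_antidiagonal.2 (Eq.refl (γ + γ)))).elim

theorem convexHull_extremePoints_convexHull {E : Type*} [AddCommGroup E] [Module ℝ E]
    [TopologicalSpace E] [T2Space E] [IsTopologicalAddGroup E] [ContinuousSMul ℝ E]
    [LocallyConvexSpace ℝ E] {s : Set E} (hs : s.Finite) :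
    convexHull ℝ ((convexHull ℝ s).extremePoints ℝ) = convexHull ℝ s := by
  have hclosed := (hs.subset (extremePoints_convexHull_subset (𝕜 := ℝ))).isClosed_convexHull ℝ
  rw [← hclosed.closure_eq]
  exact closure_convexHull_extremePoints (hs.isCompact_convexHull ℝ) (convex_convexHull ℝ s)

section NewtonPolytope

variable {n : ℕ}

theorem expPoint_injective : Function.Injective (expPoint (n := n)) := fun _ _ h =>
  Finsupp.ext fun i => Nat.cast_injective (R := ℝ) (congrFun h i)

theorem expPoint_add (α β : Fin n →₀ ℕ) : expPoint (α + β) = expPoint α + expPoint β :=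
  funext fun i => Nat.cast_add (α i) (β i)

theorem eq_of_add_eq_add_self_of_mem_extremePoints {S : Set (Fin n →₀ ℕ)} {β γ δ : Fin n →₀ ℕ}
    (hγ : expPoint γ ∈ (convexHull ℝ (expPoint '' S)).extremePoints ℝ) (hβ : β ∈ S) (hδ : δ ∈ S)
    (h : β + δ = γ + γ) : β = γ := by
  have midpoint : expPoint γ ∈ openSegment ℝ (expPoint β) (expPoint δ) := by
    refine ⟨1 / 2, 1 / 2, by norm_num, by norm_num, by norm_num, ?_⟩
    rw [← smul_add, ← expPoint_add, h, expPoint_add, smul_add, ← add_smul, add_halves, one_smul]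
  exact expPoint_injective ((mem_extremePoints_iff_left.1 hγ).2 _
    (subset_convexHull ℝ _ (Set.mem_image_of_mem _ hβ)) _
    (subset_convexHull ℝ _ (Set.mem_image_of_mem _ hδ)) midpoint)

variable {ι : Type*} [Fintype ι] (u : ι → MvPolynomial (Fin n) ℝ)

-- At a vertex of the joint Newton polytope the squares contribute without cancellation.
theorem add_self_mem_support_sum_sq {γ : Fin n →₀ ℕ}
    (hγ : expPoint γ ∈
      (convexHull ℝ (expPoint '' ⋃ i, ((u i).support : Set (Fin n →₀ ℕ)))).extremePoints ℝ) :
    γ + γ ∈ (∑ i, u i ^ 2).support := by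
  have coeff_eq : (∑ i, u i ^ 2).coeff (γ + γ) = ∑ i, (u i).coeff γ ^ 2 := by
    rw [MvPolynomial.coeff_sum]
    exact Finset.sum_congr rfl fun i _ => coeff_add_self_sq fun β hβ δ hδ =>
      eq_of_add_eq_add_self_of_mem_extremePoints hγ (Set.mem_iUnion_of_mem i hβ)
        (Set.mem_iUnion_of_mem i hδ)
  obtain ⟨i, hi⟩ : ∃ i, γ ∈ (u i).support := by
    obtain ⟨γ', hγ', heq⟩ := extremePoints_convexHull_subset hγ
    rwa [expPoint_injective heq, Set.mem_iUnion] at hγ'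
  rw [MvPolynomial.mem_support_iff, coeff_eq]
  have hpos : 0 < (u i).coeff γ ^ 2 := sq_pos_of_ne_zero (MvPolynomial.mem_support_iff.1 hi)
  exact (Finset.sum_pos' (fun j _ => sq_nonneg ((u j).coeff γ)) ⟨i, Finset.mem_univ i, hpos⟩).ne'

theorem expPoint_two_nsmul_mem_of_mem_support (i : ι) {α : Fin n →₀ ℕ} (hα : α ∈ (u i).support) :
    expPoint (2 • α) ∈
      convexHull ℝ (expPoint '' ((∑ i, u i ^ 2).support : Set (Fin n →₀ ℕ))) := by
  set S : Set (Fin n →₀ ℕ) := ⋃ i, ((u i).support : Set (Fin n →₀ ℕ))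
  set V := (convexHull ℝ (expPoint '' S)).extremePoints ℝ with hV
  have finite_S : S.Finite := Set.finite_iUnion fun i => (u i).support.finite_toSet
  have mem_hull : expPoint α ∈ convexHull ℝ V := by
    rw [hV, convexHull_extremePoints_convexHull (finite_S.image _)]
    exact subset_convexHull ℝ _ (Set.mem_image_of_mem _ (Set.mem_iUnion_of_mem i hα))
  have double_vertices : (2 : ℝ) • V ⊆
      expPoint '' ((∑ i, u i ^ 2).support : Set (Fin n →₀ ℕ)) := by
    rintro _ ⟨p, hp, rfl⟩
    obtain ⟨γ, -, rfl⟩ := extremePoints_convexHull_subset hp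
    exact ⟨γ + γ, add_self_mem_support_sum_sq u hp, by rw [expPoint_add, ← two_smul ℝ]⟩
  rw [two_smul, expPoint_add, ← two_smul ℝ]
  refine convexHull_mono double_vertices ?_
  rw [convexHull_smul]
  exact Set.smul_mem_smul_set mem_hull

end NewtonPolytope

section FarkasCertificate

variable {n : ℕ} {f : MvPolynomial (Fin n) ℝ} {T : Set (Fin n →₀ ℕ)} {y : (Fin n →₀ ℕ) → ℚ}

theorem support_mul_sum_sq_subset {l : ℕ} {v : Fin l → MvPolynomial (Fin n) ℝ}
    (hv : ∀ j, ((v j).support : Set (Fin n →₀ ℕ)) ⊆ T) :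
    ((f * ∑ j, v j ^ 2).support : Set (Fin n →₀ ℕ)) ⊆ f.support + T + T := by
  classical
  rw [Finset.mul_sum]
  intro α hα
  obtain ⟨j, -, hj⟩ := Finset.mem_biUnion.1 (MvPolynomial.support_sum hα)
  rw [sq, ← mul_assoc] at hj
  obtain ⟨β, hβ, γ, hγ, rfl⟩ := Finset.mem_add.1 (MvPolynomial.support_mul _ _ hj)
  obtain ⟨β', hβ', γ', hγ', rfl⟩ := Finset.mem_add.1 (MvPolynomial.support_mul _ _ hβ)
  exact Set.add_mem_add (Set.add_mem_add hβ' (hv j hγ')) (hv j hγ)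

theorem IsFarkasCertificate.mul_sum_sq_ne_sum_sq (hy : IsFarkasCertificate f T y) {l l' : ℕ}
    (u : Fin l → MvPolynomial (Fin n) ℝ) {v : Fin l' → MvPolynomial (Fin n) ℝ}
    (hv : ∀ j, ((v j).support : Set (Fin n →₀ ℕ)) ⊆ T) (hne : ∑ j, v j ^ 2 ≠ 0) :
    f * ∑ j, v j ^ 2 ≠ ∑ i, u i ^ 2 := by
  intro h
  have supp_u : ∀ i, ((u i).support : Set (Fin n →₀ ℕ)) ⊆ sparseTerms f T := fun i α hα =>
    convexHull_mono (Set.image_mono (h ▸ support_mul_sum_sq_subset hv))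
      (expPoint_two_nsmul_mem_of_mem_support u i hα)
  have nonneg : 0 ≤ momentForm y (∑ i, u i ^ 2) := by
    rw [momentForm_sum]
    exact Finset.sum_nonneg fun i _ => hy.2.1 _ (supp_u i)
  obtain ⟨j, -, hj⟩ := Finset.exists_ne_zero_of_sum_ne_zero hne
  have neg : momentForm y (f * ∑ j, v j ^ 2) < 0 := by
    rw [Finset.mul_sum, momentForm_sum]
    refine Finset.sum_neg' (fun k _ => ?_) ⟨j, Finset.mem_univ j,
      hy.2.2 _ (pow_ne_zero_iff two_ne_zero |>.1 hj) (hv j)⟩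
    obtain hk | hk := eq_or_ne (v k) 0
    · simp [hk, momentForm]
    · exact (hy.2.2 _ hk (hv k)).le
  exact (h ▸ neg).not_ge nonneg

theorem IsFarkasCertificate.algebraMap_notMem_RSOS (hy : IsFarkasCertificate f T y) :
    algebraMap _ (FractionRing (MvPolynomial (Fin n) ℝ)) f ∉ RSOS T := by
  rintro ⟨l, l', u, v, hv, hne, h⟩
  have hinj := IsFractionRing.injective (MvPolynomial (Fin n) ℝ)
    (FractionRing (MvPolynomial (Fin n) ℝ))
  rw [eq_div_iff ((map_ne_zero_iff _ hinj).2 hne), ← map_mul] at h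
  exact hy.mul_sum_sq_ne_sum_sq u hv hne (hinj h)

theorem IsFarkasCertificate.not_isSumSq (hT : 0 ∈ T) (hy : IsFarkasCertificate f T y) :
    ¬ IsSumSq f := by
  intro hf
  obtain ⟨l, u, hu⟩ := exists_eq_sum_sq_of_isSumSq hf
  have supp_one : ((1 : MvPolynomial (Fin n) ℝ).support : Set (Fin n →₀ ℕ)) ⊆ T := by
    rw [MvPolynomial.support_one, Finset.coe_singleton, Set.singleton_subset_iff]
    exact hT
  exact hy.mul_sum_sq_ne_sum_sq u (v := fun _ : Fin 1 => 1) (fun _ => supp_one) (by simp)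
    (by simpa using hu)

end FarkasCertificate

/-! ### Constant denominators -/

section ConstantDenominators

variable {n : ℕ} {f : MvPolynomial (Fin n) ℝ}

theorem termsLE_zero (n : ℕ) : termsLE n 0 = {0} := by
  ext α
  simp only [termsLE, Set.mem_ofPred_eq, nonpos_iff_eq_zero, Finsupp.degree_eq_zero_iff,
    Set.mem_singleton_iff]

theorem mem_sparseTerms_termsLE_zero {α : Fin n →₀ ℕ} :
    α ∈ sparseTerms f (termsLE n 0) ↔
      expPoint (2 • α) ∈ convexHull ℝ (expPoint '' (f.support : Set (Fin n →₀ ℕ))) := by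
  simp only [sparseTerms, termsLE_zero, Set.singleton_zero, add_zero, Set.mem_ofPred_eq]

theorem sdpDim_termsLE_zero :
    sdpDim f (termsLE n 0) = (sparseTerms f (termsLE n 0)).ncard + 1 := by
  rw [sdpDim, termsLE_zero n, Set.ncard_singleton]

theorem mem_sparseTerms_of_two_nsmul_mem_support {α : Fin n →₀ ℕ} (h : 2 • α ∈ f.support) :
    α ∈ sparseTerms f (termsLE n 0) :=
  mem_sparseTerms_termsLE_zero.2 (subset_convexHull ℝ _ (Set.mem_image_of_mem _ h))

theorem map_eq_sum_expPoint (φ : (Fin n →₀ ℕ) →+ ℤ) (α : Fin n →₀ ℕ) :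
    (φ α : ℝ) = ∑ i, expPoint α i * φ (Finsupp.single i 1) := by
  conv_lhs => rw [← Finsupp.univ_sum_single α]
  rw [map_sum, Int.cast_sum]
  refine Finset.sum_congr rfl fun i _ => ?_
  rw [← mul_one (α i), ← smul_eq_mul, ← Finsupp.smul_single, map_nsmul, nsmul_eq_mul,
    Int.cast_mul, Int.cast_natCast, expPoint]

theorem map_le_of_mem_sparseTerms (φ : (Fin n →₀ ℕ) →+ ℤ) {K : ℤ}
    (hf : ∀ β ∈ f.support, φ β ≤ 2 * K) {α : Fin n →₀ ℕ}
    (hα : α ∈ sparseTerms f (termsLE n 0)) : φ α ≤ K := by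
  let ℓ : (Fin n → ℝ) →ₗ[ℝ] ℝ := ∑ i, (φ (Finsupp.single i 1) : ℝ) • LinearMap.proj i
  have map_eq : ∀ β, ℓ (expPoint β) = φ β := fun β => by
    rw [map_eq_sum_expPoint φ β]
    simp only [ℓ, LinearMap.sum_apply, LinearMap.smul_apply, LinearMap.proj_apply, smul_eq_mul,
      mul_comm]
  have hull_le : convexHull ℝ (expPoint '' (f.support : Set (Fin n →₀ ℕ))) ⊆
      {p | ℓ p ≤ ((2 * K : ℤ) : ℝ)} := by
    refine convexHull_min ?_ (convex_halfSpace_le ℓ.isLinear _)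
    rintro _ ⟨β, hβ, rfl⟩
    rw [Set.mem_ofPred_eq, map_eq]
    exact Int.cast_le.2 (hf β hβ)
  have h := hull_le (mem_sparseTerms_termsLE_zero.1 hα)
  rw [Set.mem_ofPred_eq, map_eq, Int.cast_le, map_nsmul, nsmul_eq_mul, Nat.cast_two] at h
  exact le_of_mul_le_mul_left h two_pos

theorem map_eq_of_mem_sparseTerms (φ : (Fin n →₀ ℕ) →+ ℤ) {K : ℤ}
    (hf : ∀ β ∈ f.support, φ β = 2 * K) {α : Fin n →₀ ℕ}
    (hα : α ∈ sparseTerms f (termsLE n 0)) : φ α = K := by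
  refine le_antisymm (map_le_of_mem_sparseTerms φ (fun β hβ => (hf β hβ).le) hα) ?_
  refine neg_le_neg_iff.1 (map_le_of_mem_sparseTerms (-φ) (fun β hβ => ?_) hα)
  rw [AddMonoidHom.neg_apply, hf β hβ, mul_neg]

theorem isFarkasCertificate_termsLE_zero {y : (Fin n →₀ ℕ) → ℚ}
    (hsupp : Function.support y ⊆
      sparseTerms f (termsLE n 0) + sparseTerms f (termsLE n 0))
    (hsq : ∀ u : MvPolynomial (Fin n) ℝ,
      (u.support : Set (Fin n →₀ ℕ)) ⊆ sparseTerms f (termsLE n 0) → 0 ≤ momentForm y (u ^ 2))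
    (hneg : momentForm y f < 0) : IsFarkasCertificate f (termsLE n 0) y := by
  refine ⟨hsupp, hsq, fun v hv0 hv => ?_⟩
  obtain ⟨c, rfl⟩ : ∃ c, v = MvPolynomial.C c := ⟨_, MvPolynomial.totalDegree_eq_zero_iff_eq_C.1
    (Nat.le_zero.1 (Finset.sup_le fun _ hα => hv hα))⟩
  have hc : c ≠ 0 := fun h => hv0 (by rw [h, MvPolynomial.C_0])
  rw [mul_comm, ← MvPolynomial.C_pow, ← MvPolynomial.smul_eq_C_mul, ← momentLinear_apply,
    map_smul, momentLinear_apply, smul_eq_mul]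
  exact mul_neg_of_pos_of_neg (sq_pos_of_ne_zero hc) hneg

end ConstantDenominators

section NonnegCombination

variable {σ ι : Type*} [Fintype ι] {e : ι → σ →₀ ℕ} {c : ι → ℝ}

theorem mem_support_sum_monomial (hc : ∀ s, 0 ≤ c s) {β : σ →₀ ℕ} :
    β ∈ (∑ s, MvPolynomial.monomial (e s) (c s)).support ↔ ∃ s, e s = β ∧ 0 < c s := by
  classical
  have term_nonneg : ∀ s ∈ Finset.univ, 0 ≤ if e s = β then c s else 0 := fun s _ => by
    split_ifs
    exacts [hc s, le_rfl]
  rw [MvPolynomial.mem_support_iff, MvPolynomial.coeff_sum]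
  simp only [MvPolynomial.coeff_monomial, ne_eq, Finset.sum_eq_zero_iff_of_nonneg term_nonneg,
    Finset.mem_univ, true_imp_iff, not_forall, ite_eq_right_iff, exists_prop,
    (hc _).lt_iff_ne, eq_comm (a := (0 : ℝ))]

theorem totalDegree_sum_monomial {d : ℕ} (hc : ∀ s, 0 ≤ c s) (hle : ∀ s, (e s).degree ≤ d)
    (hpos : ∃ s, 0 < c s ∧ (e s).degree = d) :
    (∑ s, MvPolynomial.monomial (e s) (c s)).totalDegree = d := by
  apply le_antisymm
  · refine Finset.sup_le fun β hβ => ?_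
    obtain ⟨s, rfl, -⟩ := (mem_support_sum_monomial hc).1 hβ
    exact hle s
  · obtain ⟨s, hs, rfl⟩ := hpos
    exact MvPolynomial.le_totalDegree ((mem_support_sum_monomial hc).2 ⟨s, rfl, hs⟩)

end NonnegCombination

/-! ### Gap expansion of the MCP polynomials -/

section Permanent

variable {R : Type*} [CommRing R]

theorem mcpPerm_eq_sum (x y u v : Fin 4 → R) :
    mcpPerm x y u v = ∑ σ : Equiv.Perm (Fin 4), x (σ 0) * y (σ 1) * u (σ 2) * v (σ 3) := by
  simp only [mcpPerm, Matrix.permanent, Fin.prod_univ_four, Matrix.of_apply, Matrix.cons_val]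

theorem mcpPerm_sum_smul {κ : Type*} [Fintype κ] (s t : κ → R) (x y : κ → Fin 4 → R)
    (u v : Fin 4 → R) :
    mcpPerm (∑ k, s k • x k) (∑ l, t l • y l) u v =
      ∑ k, ∑ l, s k * t l * mcpPerm (x k) (y l) u v := by
  simp only [mcpPerm_eq_sum, Finset.sum_apply, Pi.smul_apply, smul_eq_mul, Finset.sum_mul_sum]
  simp only [Finset.sum_mul, Finset.mul_sum]
  rw [Finset.sum_comm]
  refine Finset.sum_congr rfl fun k _ => ?_
  rw [Finset.sum_comm]
  exact Finset.sum_congr rfl fun l _ => Finset.sum_congr rfl fun σ _ => by ring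

theorem mcpPerm_mcpStep_eq_card (k l i j : ℕ) :
    mcpPerm (mcpStep R k) (mcpStep R l) (mcpStep R i) (mcpStep R j) =
      (Finset.card {σ : Equiv.Perm (Fin 4) | σ 0 < k ∧ σ 1 < l ∧ σ 2 < i ∧ σ 3 < j} : R) := by
  simp only [mcpPerm_eq_sum, mcpStep, mul_ite, mul_one, mul_zero, ← ite_and, Finset.sum_boole]
  congr 3 with σ
  tauto

/-- The permanent of the matrix with columns `mcpStep k`, `mcpStep l`, `mcpStep i`, `mcpStep j`,
that is the number of placements of four rooks on the board with columns of these heights. Filling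
the columns by increasing height `k₀ ≤ k₁ ≤ k₂ ≤ k₃` leaves `kᵣ - r` choices in the `r`-th one. -/
def stepPerm (k l i j : ℕ) : ℕ :=
  (List.zipWith (· - ·) ([k, l, i, j].insertionSort (· ≤ ·)) [0, 1, 2, 3]).prod

theorem card_perm_lt_eq_stepPerm : ∀ k l i j : Fin 5,
    Finset.card {σ : Equiv.Perm (Fin 4) |
      (σ 0 : ℕ) < k ∧ (σ 1 : ℕ) < l ∧ (σ 2 : ℕ) < i ∧ (σ 3 : ℕ) < j} = stepPerm k l i j := by
  decide +kernel

theorem mcpPerm_mcpStep {k l i j : ℕ} (hk : k ≤ 4) (hl : l ≤ 4) (hi : i ≤ 4) (hj : j ≤ 4) :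
    mcpPerm (mcpStep R k) (mcpStep R l) (mcpStep R i) (mcpStep R j) = stepPerm k l i j := by
  rw [mcpPerm_mcpStep_eq_card]
  exact congrArg Nat.cast (card_perm_lt_eq_stepPerm ⟨k, Nat.lt_succ_of_le hk⟩
    ⟨l, Nat.lt_succ_of_le hl⟩ ⟨i, Nat.lt_succ_of_le hi⟩ ⟨j, Nat.lt_succ_of_le hj⟩)

/-- The parameters of `mcpColumn` as coordinates with respect to the columns `mcpStep R 1`, …,
`mcpStep R 4`. -/
def gapCoords (a b c d : R) : Fin 4 → R := ![b ^ 2, c ^ 2, d ^ 2, a]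

theorem mcpColumn_eq_sum (a b c d : R) :
    mcpColumn a b c d = ∑ k, gapCoords a b c d k • mcpStep R (k + 1) := by
  ext r
  fin_cases r <;>
    simp [mcpColumn, gapCoords, mcpStep, Fin.sum_univ_four, add_assoc, add_comm]

/-- An index `((k, k'), (l, l'))` of a product of two gap coordinates of `x` and two of `y`. -/
abbrev GapIndex : Type := (Fin 4 × Fin 4) × (Fin 4 × Fin 4)

/-- The product of gap coordinates of `x` and `y` selected by a `GapIndex`. -/
def gapProduct (x y : Fin 4 → R) (s : GapIndex) : R := x s.1.1 * x s.1.2 * (y s.2.1 * y s.2.2)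

/-- The coefficient of `gapProduct` in the expansion of `mcpForm i j` in which the first factor of
each product of permanents contributes the first gaps `k`, `l` and the second one `k'`, `l'`. -/
def gapCoeff (i j : ℕ) (s : GapIndex) : ℤ :=
  stepPerm (s.1.1 + 1) (s.2.1 + 1) i 4 * stepPerm (s.1.2 + 1) (s.2.2 + 1) j 4
    - stepPerm (s.1.1 + 1) (s.2.1 + 1) 4 4 * stepPerm (s.1.2 + 1) (s.2.2 + 1) i j

/-- Four times the symmetrization of `gapCoeff` under `k ↔ k'` and `l ↔ l'`, which leave
`gapProduct` unchanged. -/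
def symCoeff (i j : ℕ) (s : GapIndex) : ℤ :=
  gapCoeff i j s + gapCoeff i j (s.1.swap, s.2) + gapCoeff i j (s.1, s.2.swap)
    + gapCoeff i j (s.1.swap, s.2.swap)

theorem mcpForm_gap {i j : ℕ} (hi : i ≤ 4) (hj : j ≤ 4) (x y : Fin 4 → R) :
    mcpForm i j (∑ k, x k • mcpStep R (k + 1)) (∑ l, y l • mcpStep R (l + 1)) =
      ∑ s, gapProduct x y s * gapCoeff i j s := by
  have expand : ∀ {i j : ℕ}, i ≤ 4 → j ≤ 4 →
      mcpPerm (∑ k, x k • mcpStep R (k + 1)) (∑ l, y l • mcpStep R (l + 1)) (mcpStep R i)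
        (mcpStep R j) = ∑ k : Fin 4, ∑ l : Fin 4, x k * y l * stepPerm (k + 1) (l + 1) i j := by
    intro i j hi hj
    rw [mcpPerm_sum_smul]
    simp only [mcpPerm_mcpStep (Fin.is_lt _) (Fin.is_lt _) hi hj]
  rw [mcpForm, expand hi le_rfl, expand hj le_rfl, expand le_rfl le_rfl, expand hi hj]
  simp only [Finset.sum_mul_sum, ← Finset.sum_sub_distrib, Fintype.sum_prod_type]
  refine Finset.sum_congr rfl fun k _ => Finset.sum_congr rfl fun k' _ =>
    Finset.sum_congr rfl fun l _ => Finset.sum_congr rfl fun l' _ => ?_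
  simp only [gapProduct, gapCoeff]
  push_cast
  ring

theorem four_mul_mcpForm_gap {i j : ℕ} (hi : i ≤ 4) (hj : j ≤ 4) (x y : Fin 4 → R) :
    4 * mcpForm i j (∑ k, x k • mcpStep R (k + 1)) (∑ l, y l • mcpStep R (l + 1)) =
      ∑ s, gapProduct x y s * symCoeff i j s := by
  have id := mcpForm_gap hi hj x y
  set F := mcpForm i j (∑ k, x k • mcpStep R (k + 1)) (∑ l, y l • mcpStep R (l + 1))
  have permuted : ∀ τ : GapIndex ≃ GapIndex, (∀ s, gapProduct x y (τ s) = gapProduct x y s) →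
      F = ∑ s, gapProduct x y s * gapCoeff i j (τ s) := fun τ hτ => by
    rw [id, ← τ.sum_comp]
    simp only [hτ]
  have left : F = ∑ s, gapProduct x y s * gapCoeff i j (s.1.swap, s.2) :=
    permuted ((Equiv.prodComm _ _).prodCongr (Equiv.refl _)) fun _ =>
      congrArg (· * _) (mul_comm _ _)
  have right : F = ∑ s, gapProduct x y s * gapCoeff i j (s.1, s.2.swap) :=
    permuted ((Equiv.refl _).prodCongr (Equiv.prodComm _ _)) fun _ =>
      congrArg (_ * ·) (mul_comm _ _)
  have both : F = ∑ s, gapProduct x y s * gapCoeff i j (s.1.swap, s.2.swap) :=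
    permuted ((Equiv.prodComm _ _).prodCongr (Equiv.prodComm _ _)) fun _ =>
      congrArg₂ (· * ·) (mul_comm _ _) (mul_comm _ _)
  simp only [symCoeff, Int.cast_add, mul_add, Finset.sum_add_distrib]
  linear_combination id + left + right + both

end Permanent

/-! ### Terms as pairs of exponent vectors -/

/-- A term in the variables `X`, as the pair of its exponent vectors in `a, b, c, d` and in
`a', b', c', d'`; unlike for `Fin 8 →₀ ℕ`, equality of such pairs is decided by evaluation. -/
abbrev PairTerm : Type := (Fin 4 → ℕ) × (Fin 4 → ℕ)

/-- The term represented by a pair of exponent vectors. -/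
noncomputable def joinTerm : PairTerm ≃+ (Fin 8 →₀ ℕ) where
  toEquiv := (Fin.appendEquiv 4 4).trans Finsupp.equivFunOnFinite.symm
  map_add' p q := by
    ext r
    change Fin.append (p.1 + q.1) (p.2 + q.2) r = Fin.append p.1 p.2 r + Fin.append q.1 q.2 r
    refine Fin.addCases (m := 4) (n := 4) (fun r => ?_) (fun r => ?_) r
    · simp only [Fin.append_left, Pi.add_apply]
    · simp only [Fin.append_right, Pi.add_apply]

theorem joinTerm_apply (p : PairTerm) : ⇑(joinTerm p) = Fin.append p.1 p.2 := rfl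

theorem degree_joinTerm (p : PairTerm) : (joinTerm p).degree = ∑ r, p.1 r + ∑ r, p.2 r := by
  rw [Finsupp.degree_eq_sum, joinTerm_apply]
  exact (Fin.sum_univ_add (a := 4) (b := 4) _).trans (by
    simp only [Fin.append_left, Fin.append_right])

/-- The exponent vector of the `k`-th gap coordinate in the variables `a, b, c, d`. -/
def gapExp : Fin 4 → Fin 4 → ℕ := ![![0, 2, 0, 0], ![0, 0, 2, 0], ![0, 0, 0, 2], ![1, 0, 0, 0]]

/-- The term of `gapProduct` at two generic columns. -/
def gapTerm (s : GapIndex) : PairTerm := (gapExp s.1.1 + gapExp s.1.2, gapExp s.2.1 + gapExp s.2.2)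

open MvPolynomial in
theorem gapCoords_X_left (k : Fin 4) :
    gapCoords (X 0 : MvPolynomial (Fin 8) ℝ) (X 1) (X 2) (X 3) k =
      monomial (joinTerm (gapExp k, 0)) 1 := by
  rw [monomial_eq, Finsupp.prod_fintype _ _ fun _ => pow_zero _, Fin.prod_univ_eight]
  fin_cases k <;> simp [gapCoords, gapExp, joinTerm_apply, Fin.append, Fin.addCases]

open MvPolynomial in
theorem gapCoords_X_right (l : Fin 4) :
    gapCoords (X 4 : MvPolynomial (Fin 8) ℝ) (X 5) (X 6) (X 7) l =
      monomial (joinTerm (0, gapExp l)) 1 := by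
  rw [monomial_eq, Finsupp.prod_fintype _ _ fun _ => pow_zero _, Fin.prod_univ_eight]
  fin_cases l <;> simp [gapCoords, gapExp, joinTerm_apply, Fin.append, Fin.addCases]

theorem mcpPoly_eq_sum_monomial {i j : ℕ} (hi : i ≤ 4) (hj : j ≤ 4) :
    mcpPoly i j = ∑ s, MvPolynomial.monomial (joinTerm (gapTerm s)) ((symCoeff i j s : ℝ) / 4) := by
  have four_eq : (4 : MvPolynomial (Fin 8) ℝ) = MvPolynomial.C 4 := (map_ofNat _ 4).symm
  have four_ne_zero : (4 : MvPolynomial (Fin 8) ℝ) ≠ 0 :=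
    four_eq ▸ MvPolynomial.C_ne_zero.2 (by norm_num)
  apply mul_left_cancel₀ four_ne_zero
  rw [mcpPoly, mcpColumn_eq_sum, mcpColumn_eq_sum, four_mul_mcpForm_gap hi hj, Finset.mul_sum]
  refine Finset.sum_congr rfl fun s _ => ?_
  simp only [gapProduct, gapCoords_X_left, gapCoords_X_right, MvPolynomial.monomial_mul, ← map_add,
    Prod.mk_add_mk, add_zero, zero_add, mul_one]
  rw [four_eq, MvPolynomial.C_mul_monomial, mul_div_cancel₀ _ (by norm_num),
    ← map_intCast (MvPolynomial.C (σ := Fin 8) (R := ℝ)), mul_comm,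
    MvPolynomial.C_mul_monomial, mul_one, gapTerm]

/-! ### Half Newton polytopes -/

/-- The exponent vectors of weight `m` in one group of variables, where `a` has weight `2` and
`b, c, d` have weight `1`. -/
def weightTerms (m : ℕ) : Finset (Fin 4 → ℕ) :=
  {p ∈ Fintype.piFinset fun _ => Finset.range (m + 1) | 2 * p 0 + p 1 + p 2 + p 3 = m}

theorem mem_weightTerms {m : ℕ} {p : Fin 4 → ℕ} :
    p ∈ weightTerms m ↔ 2 * p 0 + p 1 + p 2 + p 3 = m := by
  rw [weightTerms, Finset.mem_filter, and_iff_right_iff_imp, Fintype.mem_piFinset]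
  intro h r
  rw [Finset.mem_range]
  fin_cases r <;> dsimp <;> omega

/-- The pairing of two integral weight vectors, one for each group of variables, with a term. -/
def pairWeight (w w' : Fin 4 → ℤ) : PairTerm →+ ℤ where
  toFun α := ∑ r, (w r * α.1 r + w' r * α.2 r)
  map_zero' := by simp
  map_add' α β := by
    rw [← Finset.sum_add_distrib]
    exact Finset.sum_congr rfl fun r _ => by
      simp only [Prod.fst_add, Prod.snd_add, Pi.add_apply, Nat.cast_add]; ring

/-- The terms of weight `2` in each group of variables that satisfy the inequalities
`pairWeight w w ≤ K` for `(w, K)` in the list `W`. -/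
def halfTerms (W : List ((Fin 4 → ℤ) × ℤ)) : Finset PairTerm :=
  {α ∈ weightTerms 2 ×ˢ weightTerms 2 | ∀ c ∈ W, pairWeight c.1 c.1 α ≤ c.2}

theorem mem_add_halfTerms {W : List ((Fin 4 → ℤ) × ℤ)} {γ : PairTerm} :
    γ ∈ halfTerms W + halfTerms W ↔
      ∃ α ∈ halfTerms W, α + (γ - α) = γ ∧ γ - α ∈ halfTerms W := by
  rw [Finset.mem_add]
  constructor
  · rintro ⟨α, hα, β, hβ, rfl⟩
    exact ⟨α, hα, by rw [add_tsub_cancel_left], by rwa [add_tsub_cancel_left]⟩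
  · rintro ⟨α, hα, hsum, hβ⟩
    exact ⟨α, hα, γ - α, hβ, hsum⟩

theorem add_halfTerms_eq_filter (W : List ((Fin 4 → ℤ) × ℤ)) :
    halfTerms W + halfTerms W = {γ ∈ weightTerms 4 ×ˢ weightTerms 4 |
      ∃ α ∈ halfTerms W, α + (γ - α) = γ ∧ γ - α ∈ halfTerms W} := by
  ext γ
  rw [Finset.mem_filter, ← mem_add_halfTerms, iff_and_self, Finset.mem_product, Finset.mem_add]
  simp only [halfTerms, Finset.mem_filter, Finset.mem_product, mem_weightTerms]
  rintro ⟨α, ⟨hα, -⟩, β, ⟨hβ, -⟩, rfl⟩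
  simp only [Prod.fst_add, Prod.snd_add, Pi.add_apply]
  omega

theorem pairWeight_gapTerm : ∀ s, pairWeight ![2, 1, 1, 1] 0 (gapTerm s) = 2 * 2 ∧
    pairWeight 0 ![2, 1, 1, 1] (gapTerm s) = 2 * 2 := by
  decide +kernel

theorem degree_joinTerm_gapTerm_le (s : GapIndex) : (joinTerm (gapTerm s)).degree ≤ 8 := by
  rw [degree_joinTerm]
  revert s
  decide +kernel

/-- The inequalities in `W`, together with bihomogeneity, cut out half the Newton polytope of
`mcpPoly i j`. Nonnegativity of the coefficients excludes cancellation between terms. -/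
structure CutsOutHalfPolytope (i j : ℕ) (W : List ((Fin 4 → ℤ) × ℤ)) : Prop where
  le_four : i ≤ 4 ∧ j ≤ 4
  symCoeff_nonneg : ∀ s, 0 ≤ symCoeff i j s
  pairWeight_le : ∀ s, 0 < symCoeff i j s → ∀ c ∈ W, pairWeight c.1 c.1 (gapTerm s) ≤ 2 * c.2
  exists_gapTerm_eq : ∀ α ∈ halfTerms W, ∃ s, gapTerm s = 2 • α ∧ 0 < symCoeff i j s

namespace CutsOutHalfPolytope

variable {i j : ℕ} {W : List ((Fin 4 → ℤ) × ℤ)}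

theorem mem_support_mcpPoly (h : CutsOutHalfPolytope i j W) {β : Fin 8 →₀ ℕ} :
    β ∈ (mcpPoly i j).support ↔ ∃ s, joinTerm (gapTerm s) = β ∧ 0 < symCoeff i j s := by
  rw [mcpPoly_eq_sum_monomial h.le_four.1 h.le_four.2, mem_support_sum_monomial fun s =>
    div_nonneg (Int.cast_nonneg (h.symCoeff_nonneg s)) zero_le_four]
  simp only [div_pos_iff_of_pos_right (zero_lt_four (α := ℝ)), Int.cast_pos]

theorem sparseTerms_mcpPoly (h : CutsOutHalfPolytope i j W) :
    sparseTerms (mcpPoly i j) (termsLE 8 0) = joinTerm '' (halfTerms W : Set PairTerm) := by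
  apply Set.Subset.antisymm
  · intro α hα
    obtain ⟨p, rfl⟩ := joinTerm.surjective α
    refine Set.mem_image_of_mem _ (Finset.mem_coe.2 ?_)
    let pull : (PairTerm →+ ℤ) → (Fin 8 →₀ ℕ) →+ ℤ := fun φ =>
      φ.comp joinTerm.symm.toAddMonoidHom
    have pull_joinTerm : ∀ φ q, pull φ (joinTerm q) = φ q := fun φ q =>
      congrArg φ (joinTerm.symm_apply_apply q)
    have weight_eq : ∀ φ : PairTerm →+ ℤ, (∀ s, φ (gapTerm s) = 2 * 2) → φ p = 2 :=
      fun φ hφ => by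
        rw [← pull_joinTerm φ p]
        refine map_eq_of_mem_sparseTerms (pull φ) (fun β hβ => ?_) hα
        obtain ⟨s, rfl, -⟩ := h.mem_support_mcpPoly.1 hβ
        rw [pull_joinTerm, hφ]
    have left := weight_eq _ fun s => (pairWeight_gapTerm s).1
    have right := weight_eq _ fun s => (pairWeight_gapTerm s).2
    simp only [pairWeight, AddMonoidHom.coe_mk, ZeroHom.coe_mk, Fin.sum_univ_four, Pi.zero_apply,
      Matrix.cons_val, zero_mul, one_mul, add_zero, zero_add] at left right
    simp only [halfTerms, Finset.mem_filter, Finset.mem_product, mem_weightTerms]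
    refine ⟨⟨by omega, by omega⟩, fun c hc => ?_⟩
    rw [← pull_joinTerm _ p]
    refine map_le_of_mem_sparseTerms (pull _) (fun β hβ => ?_) hα
    obtain ⟨s, rfl, hs⟩ := h.mem_support_mcpPoly.1 hβ
    rw [pull_joinTerm]
    exact h.pairWeight_le s hs c hc
  · rintro _ ⟨p, hp, rfl⟩
    obtain ⟨s, hs, hpos⟩ := h.exists_gapTerm_eq p hp
    refine mem_sparseTerms_of_two_nsmul_mem_support (h.mem_support_mcpPoly.2 ⟨s, ?_, hpos⟩)
    rw [hs, map_nsmul]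

theorem totalDegree_mcpPoly (h : CutsOutHalfPolytope i j W)
    (hd : 0 < symCoeff i j ((2, 2), (2, 2))) : (mcpPoly i j).totalDegree = 8 := by
  rw [mcpPoly_eq_sum_monomial h.le_four.1 h.le_four.2]
  refine totalDegree_sum_monomial
    (fun s => div_nonneg (Int.cast_nonneg (h.symCoeff_nonneg s)) zero_le_four)
    degree_joinTerm_gapTerm_le ⟨_, div_pos (Int.cast_pos.2 hd) zero_lt_four, ?_⟩
  rw [degree_joinTerm]
  decide +kernel

theorem sdpDim_mcpPoly (h : CutsOutHalfPolytope i j W) :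
    sdpDim (mcpPoly i j) (termsLE 8 0) = (halfTerms W).card + 1 := by
  rw [sdpDim_termsLE_zero, h.sparseTerms_mcpPoly, Set.ncard_image_of_injective _ joinTerm.injective,
    Set.ncard_coe_finset]

theorem sparseTerms_add_mcpPoly (h : CutsOutHalfPolytope i j W) :
    sparseTerms (mcpPoly i j) (termsLE 8 0) + sparseTerms (mcpPoly i j) (termsLE 8 0) =
      joinTerm '' ((halfTerms W + halfTerms W : Finset PairTerm) : Set PairTerm) := by
  rw [h.sparseTerms_mcpPoly, ← Set.image_add, Finset.coe_add]

theorem certificateLength_mcpPoly (h : CutsOutHalfPolytope i j W) :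
    certificateLength (mcpPoly i j) (termsLE 8 0) = (halfTerms W + halfTerms W).card := by
  rw [certificateLength, h.sparseTerms_add_mcpPoly,
    Set.ncard_image_of_injective _ joinTerm.injective, Set.ncard_coe_finset]

end CutsOutHalfPolytope

/-! ### Farkas certificates -/

theorem isFarkasCertificate_mcpPoly {i j : ℕ} {W : List ((Fin 4 → ℤ) × ℤ)}
    (h : CutsOutHalfPolytope i j W) {κ : Type*} [Fintype κ] {y : PairTerm → ℤ}
    (v : κ → PairTerm → ℤ) (hsupp : ∀ γ, y γ ≠ 0 → γ ∈ halfTerms W + halfTerms W)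
    (hgram : ∀ α ∈ halfTerms W, ∀ β ∈ halfTerms W, y (α + β) = ∑ k, v k α * v k β)
    (hneg : ∑ s, symCoeff i j s * y (gapTerm s) < 0) :
    IsFarkasCertificate (mcpPoly i j) (termsLE 8 0) fun γ => (y (joinTerm.symm γ) : ℚ) := by
  refine isFarkasCertificate_termsLE_zero (fun γ hγ => ?_) (fun u hu => ?_) ?_
  · rw [h.sparseTerms_add_mcpPoly]
    exact ⟨joinTerm.symm γ, hsupp _ (Int.cast_ne_zero.1 hγ), joinTerm.apply_symm_apply γ⟩
  · rw [h.sparseTerms_mcpPoly] at hu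
    refine momentForm_sq_nonneg_of_gram _ (fun k γ => (v k (joinTerm.symm γ) : ℝ))
      fun α hα β hβ => ?_
    obtain ⟨p, hp, rfl⟩ := hu hα
    obtain ⟨q, hq, rfl⟩ := hu hβ
    simp only [← map_add, joinTerm.symm_apply_apply, hgram p hp q hq]
    push_cast
    rfl
  · have moment_eq : momentForm (fun γ => (y (joinTerm.symm γ) : ℚ)) (mcpPoly i j) =
        ((∑ s, symCoeff i j s * y (gapTerm s) : ℤ) : ℝ) / 4 := by
      rw [mcpPoly_eq_sum_monomial h.le_four.1 h.le_four.2, momentForm_sum, Int.cast_sum,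
        Finset.sum_div]
      refine Finset.sum_congr rfl fun s _ => ?_
      rw [momentForm_monomial, joinTerm.symm_apply_apply, Rat.cast_intCast, Int.cast_mul,
        div_mul_eq_mul_div]
    rw [moment_eq]
    exact div_neg_of_neg_of_pos (Int.cast_lt_zero.2 hneg) zero_lt_four

/-- The function on terms whose value at the pair `(m p, m q)` is `M p q` and which vanishes at all
other terms. -/
def tableValue {r : ℕ} (m : Fin r → Fin 4 → ℕ) (M : Fin r → Fin r → ℤ) (γ : PairTerm) : ℤ :=
  ∑ p, if γ.1 = m p then ∑ q, if γ.2 = m q then M p q else 0 else 0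

theorem mem_of_tableValue_ne_zero {r : ℕ} {m : Fin r → Fin 4 → ℕ} {M : Fin r → Fin r → ℤ}
    {S : Finset PairTerm}
    (h : ∀ p q, M p q ≠ 0 → (m p, m q) ∈ S) (γ : PairTerm) (hγ : tableValue m M γ ≠ 0) :
    γ ∈ S := by
  obtain ⟨p, -, hp⟩ := Finset.exists_ne_zero_of_sum_ne_zero hγ
  obtain ⟨hγp, hp⟩ := ite_ne_right_iff.1 hp
  obtain ⟨q, -, hq⟩ := Finset.exists_ne_zero_of_sum_ne_zero hp
  obtain ⟨hγq, hq⟩ := ite_ne_right_iff.1 hq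
  rw [show γ = (m p, m q) from Prod.ext hγp hγq]
  exact h p q hq

/-! ### The polynomials `p₁₂`, `p₂₂`, `p₂₃` -/

/-- The inequalities `2 b + c ≤ 3`, `c ≤ 2` (each exponent summed over both groups) for `p₁₂`. -/
def facets₁₂ : List ((Fin 4 → ℤ) × ℤ) := [(![0, 2, 1, 0], 3), (![0, 0, 1, 0], 2)]

/-- The inequality `b + c ≤ 2` (each exponent summed over both groups) for `p₂₂`. -/
def facets₂₂ : List ((Fin 4 → ℤ) × ℤ) := [(![0, 1, 1, 0], 2)]

/-- The inequalities `2 b + c - d ≤ 4`, `c ≤ 3` (each exponent summed over both groups) for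
`p₂₃`. -/
def facets₂₃ : List ((Fin 4 → ℤ) × ℤ) := [(![0, 2, 1, -1], 4), (![0, 0, 1, 0], 3)]

theorem cutsOutHalfPolytope_facets₁₂ : CutsOutHalfPolytope 1 2 facets₁₂ :=
  ⟨by decide, by decide +kernel, by decide +kernel, by decide +kernel⟩

theorem cutsOutHalfPolytope_facets₂₂ : CutsOutHalfPolytope 2 2 facets₂₂ :=
  ⟨by decide, by decide +kernel, by decide +kernel, by decide +kernel⟩

theorem cutsOutHalfPolytope_facets₂₃ : CutsOutHalfPolytope 2 3 facets₂₃ :=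
  ⟨by decide, by decide +kernel, by decide +kernel, by decide +kernel⟩

/-- The moments of the certificate for `p₁₂`, at products of `a²`, `ac²`, `ad²`, `c⁴`, `c²d²`, `d⁴`
with the primed copies of these terms. -/
def moments₁₂ : PairTerm → ℤ :=
  tableValue
    ![![2, 0, 0, 0], ![1, 0, 2, 0], ![1, 0, 0, 2], ![0, 0, 4, 0], ![0, 0, 2, 2], ![0, 0, 0, 4]]
    ![![64, -32, -32, 17, 16, 16],
      ![-32, 15, 16, 0, -6, -8],
      ![-32, 16, 16, -10, -8, -8],
      ![17, 0, -10, 0, 0, 8],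
      ![16, -6, -8, 0, 0, 4],
      ![16, -8, -8, 8, 4, 4]]

/-- Vectors with Gram matrix `moments₁₂`, supported on products of `a`, `c²`, `cd`, `d²` with their
primed copies. On their supports, the first and the last two are twice the formal values of the
terms at `a = a' = 2`, `c² = d² = c'² = d'² = -1`, `cd = c'd' = 1`. -/
def gramVectors₁₂ (k : Fin 4) : PairTerm → ℤ :=
  tableValue ![![1, 0, 0, 0], ![0, 0, 2, 0], ![0, 0, 1, 1], ![0, 0, 0, 2]]
    (![![![8, -4, 0, -4], ![-4, 0, 0, 2], ![0, 0, 0, 0], ![-4, 2, 0, 2]],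
      ![![0, 1, 0, 0], ![-1, 0, 0, 2], ![0, 0, 0, 0], ![0, -2, 0, 0]],
      ![![0, 0, 4, 0], ![0, 0, 0, 0], ![0, 0, 0, 0], ![0, 0, -2, 0]],
      ![![0, 0, 0, 0], ![0, 0, 0, 0], ![4, 0, 0, -2], ![0, 0, 0, 0]]] k)

/-- The moments of the common certificate for `p₂₂` and `p₂₃`, at products of `a²`, `ab²`, `ac²`,
`b⁴`, `c⁴` with the primed copies of these terms. -/
def moments₂ : PairTerm → ℤ :=
  tableValue ![![2, 0, 0, 0], ![1, 2, 0, 0], ![1, 0, 2, 0], ![0, 4, 0, 0], ![0, 0, 4, 0]]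
    ![![2, 0, -2, 2, 2],
      ![-3, -3, 3, 0, 0],
      ![-1, 1, 1, 0, 0],
      ![9, 0, 0, 0, 0],
      ![1, 0, 0, 0, 0]]

/-- Vectors with Gram matrix `moments₂`, supported on products of `a`, `b²`, `c²` with their primed
copies. -/
def gramVectors₂ (k : Fin 2) : PairTerm → ℤ :=
  tableValue ![![1, 0, 0, 0], ![0, 2, 0, 0], ![0, 0, 2, 0]]
    (![![![1, 1, -1], ![-3, 0, 0], ![0, 0, 0]], ![![1, -1, -1], ![0, 0, 0], ![-1, 0, 0]]] k)

theorem isFarkasCertificate_moments₁₂ : IsFarkasCertificate (mcpPoly 1 2) (termsLE 8 0)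
    fun γ => (moments₁₂ (joinTerm.symm γ) : ℚ) := by
  refine isFarkasCertificate_mcpPoly cutsOutHalfPolytope_facets₁₂ gramVectors₁₂
    (mem_of_tableValue_ne_zero ?_) (by decide +kernel) (by decide +kernel)
  simp only [mem_add_halfTerms]
  decide +kernel

theorem isFarkasCertificate_moments₂_mcpPoly_two_two :
    IsFarkasCertificate (mcpPoly 2 2) (termsLE 8 0)
      fun γ => (moments₂ (joinTerm.symm γ) : ℚ) := by
  refine isFarkasCertificate_mcpPoly cutsOutHalfPolytope_facets₂₂ gramVectors₂
    (mem_of_tableValue_ne_zero ?_) (by decide +kernel) (by decide +kernel)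
  simp only [mem_add_halfTerms]
  decide +kernel

theorem isFarkasCertificate_moments₂_mcpPoly_two_three :
    IsFarkasCertificate (mcpPoly 2 3) (termsLE 8 0)
      fun γ => (moments₂ (joinTerm.symm γ) : ℚ) := by
  refine isFarkasCertificate_mcpPoly cutsOutHalfPolytope_facets₂₃ gramVectors₂
    (mem_of_tableValue_ne_zero ?_) (by decide +kernel) (by decide +kernel)
  simp only [mem_add_halfTerms]
  decide +kernel

theorem card_halfTerms₁₂ : (halfTerms facets₁₂).card = 23 := by decide +kernel

theorem card_halfTerms₂₂ : (halfTerms facets₂₂).card = 28 := by decide +kernel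

theorem card_halfTerms₂₃ : (halfTerms facets₂₃).card = 38 := by decide +kernel

theorem card_add_halfTerms₁₂ : (halfTerms facets₁₂ + halfTerms facets₁₂).card = 189 := by
  rw [add_halfTerms_eq_filter]
  decide +kernel

theorem card_add_halfTerms₂₂ : (halfTerms facets₂₂ + halfTerms facets₂₂).card = 255 := by
  rw [add_halfTerms_eq_filter]
  decide +kernel

theorem card_add_halfTerms₂₃ : (halfTerms facets₂₃ + halfTerms facets₂₃).card = 372 := by
  rw [add_halfTerms_eq_filter]
  decide +kernel

theorem mainTheorem9 :
    (∀ f ∈ ({mcpPoly 1 2, mcpPoly 2 2, mcpPoly 2 3} : Set (MvPolynomial (Fin 8) ℝ)),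
      f.totalDegree = 8 ∧
      (∃ y : (Fin 8 →₀ ℕ) → ℚ, IsFarkasCertificate f (termsLE 8 0) y) ∧
      ¬ IsSumSq f ∧
      algebraMap (MvPolynomial (Fin 8) ℝ) (FractionRing (MvPolynomial (Fin 8) ℝ)) f
        ∉ RSOS (termsLE 8 0)) ∧
    (sdpDim (mcpPoly 1 2) (termsLE 8 0) = 24 ∧
      certificateLength (mcpPoly 1 2) (termsLE 8 0) = 189) ∧
    (sdpDim (mcpPoly 2 2) (termsLE 8 0) = 29 ∧
      certificateLength (mcpPoly 2 2) (termsLE 8 0) = 255) ∧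
    (sdpDim (mcpPoly 2 3) (termsLE 8 0) = 39 ∧
      certificateLength (mcpPoly 2 3) (termsLE 8 0) = 372) := by
  have h₁₂ := cutsOutHalfPolytope_facets₁₂
  have h₂₂ := cutsOutHalfPolytope_facets₂₂
  have h₂₃ := cutsOutHalfPolytope_facets₂₃
  refine ⟨?_, ⟨?_, ?_⟩, ⟨?_, ?_⟩, ⟨?_, ?_⟩⟩
  · intro f hf
    obtain ⟨hdeg, y, hy⟩ : f.totalDegree = 8 ∧ ∃ y, IsFarkasCertificate f (termsLE 8 0) y := by
      rcases hf with rfl | rfl | rfl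
      · exact ⟨h₁₂.totalDegree_mcpPoly (by decide), _, isFarkasCertificate_moments₁₂⟩
      · exact ⟨h₂₂.totalDegree_mcpPoly (by decide), _,
          isFarkasCertificate_moments₂_mcpPoly_two_two⟩
      · exact ⟨h₂₃.totalDegree_mcpPoly (by decide), _,
          isFarkasCertificate_moments₂_mcpPoly_two_three⟩
    have zero_mem : 0 ∈ termsLE 8 0 := termsLE_zero 8 ▸ Set.mem_singleton 0
    exact ⟨hdeg, ⟨y, hy⟩, hy.not_isSumSq zero_mem, hy.algebraMap_notMem_RSOS⟩
  · rw [h₁₂.sdpDim_mcpPoly, card_halfTerms₁₂]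
  · rw [h₁₂.certificateLength_mcpPoly, card_add_halfTerms₁₂]
  · rw [h₂₂.sdpDim_mcpPoly, card_halfTerms₂₂]
  · rw [h₂₂.certificateLength_mcpPoly, card_add_halfTerms₂₂]
  · rw [h₂₃.sdpDim_mcpPoly, card_halfTerms₂₃]
  · rw [h₂₃.certificateLength_mcpPoly, card_add_halfTerms₂₃]
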